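/- Let $d\ge 1$ and $1\le p<\infty$, let $c_d=|B(0,1)|$ be the volume of the unit ball of $\mathbb R^d$, and let $\eta(r)=(r/c_d)^{1/d}$. **Critical functions.** For a measurable kernel $\nu:\mathbb R^d\setminus\{0\}\to[0,\infty]$ let $\nu^*(\rho)=\inf\{s>0:\ |\{\nu>s\}|\le c_d\rho^d\}$ be its symmetric decreasing rearrangement, as a function of the radius $\rho$, and put $$w(r)=\Big(r\int_{\{\nu<\nu^*(\eta(r))\}}\nu(h)\,dh\Big)^{1/p},\qquad w(0)=0,\quad w(\infty)=\infty .$$ If $w:[0,\infty]\to[0,\infty]$ is bijective, the function $\phi(t)=1/w^{-1}(1/t)$, $t\in[0,\infty]$, is called a critical function of $\nu$. If $\nu$ is radial and almost decreasing (there is $\kappa\in(0,1]$ with $\kappa\,\nu(x)\le\nu(y)$ whenever $|x|\ge|y|>0$), then the function $\phi$ obtained in the same way from $w(r)=\big(r\int_{|h|\ge\eta(r)}\nu(h)\,dh\big)^{1/p}$, when this $w$ is bijective, is also called a critical function of $\nu$. **Norms.** For $\phi:[0,\infty]\to[0,\infty]$, let $L^\phi(\mathbb R^d)$ be the set of measurable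 $u:\mathbb R^d\to\mathbb R$ with $\int_{\mathbb R^d}\phi(|u(x)|/\lambda)\,dx<\infty$ for some $\lambda>0$, and let $\|u\|_{L^\phi(\mathbb R^d)}=\inf\{\lambda>0:\int_{\mathbb R^d}\phi(|u(x)|/\lambda)\,dx\le1\}$. Put $$|u|_{W^p_\nu(\mathbb R^d)}=\Big(\iint_{\mathbb R^d\times\mathbb R^d}|u(x)-u(y)|^p\,\nu(x-y)\,dy\,dx\Big)^{1/p}\in[0,\infty].$$ **Theorem.** Let $\nu,\nu_1,\nu_2:\mathbb R^d\setminus\{0\}\to[0,\infty]$ be measurable with critical functions $\phi,\phi_1,\phi_2$ respectively. Assume that for $i=1,2$ the function $t\mapsto\phi_i(t^{1/p})$ is convex on $[0,\infty]$, and that there is $\theta_i>0$ such that $\phi_i(t)\,\phi_i\big(\theta_i\tfrac st\big)\le\phi_i(s)$ for all $s\le t$. (i) If $\phi(t)=\max(\phi_1(t),\phi_2(t))$ for all $t$ and there are constants $c_2\ge c_1>0$ with $c_1\nu(h)\le\max(\nu_1(h),\nu_2(h))\le c_2\nu(h)$ for all $h\neq0$, then there is a constant $C>0$ such that $$\|u\|_{L^\phi(\mathbb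 R^d)}\le C\,|u|_{W^p_\nu(\mathbb R^d)}\qquad\text{for all }u\in L^\phi(\mathbb R^d).$$ (The function $\phi$ itself is not assumed to satisfy a growth condition.) (ii) If $\phi(t)=\min(\phi_1(t),\phi_2(t))$ for all $t$ (so that $\phi$ need not be convex), put $$\phi_{\min}(t)=\int_0^t\frac{\min(\phi_1(s),\phi_2(s))}{s}\,ds .$$ Then there is a constant $C>0$ such that $$\|u\|_{L^{\phi_{\min}}(\mathbb R^d)}\le C\,|u|_{W^p_\nu(\mathbb R^d)}\quad\text{for all }u\in L^{\phi_{\min}}(\mathbb R^d),$$ and also $\|u\|_{L^{\phi}(\mathbb R^d)}\le C\,|u|_{W^p_\nu(\mathbb R^d)}$ for all $u\in L^{\phi}(\mathbb R^d)$. -/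

import Mathlib

open MeasureTheory
open scoped ENNReal NNReal

noncomputable section

/-- The Euclidean space `ℝ^d`. -/
abbrev RSpace (d : ℕ) : Type := EuclideanSpace ℝ (Fin d)

/-
A kernel `ν : ℝ^d \ {0} → [0, ∞]` is represented by a function on all of `ℝ^d`. For `d ≥ 1` the
value at the origin plays no role: it enters only through Lebesgue integrals and Lebesgue measures
of level sets, and every pointwise condition below is imposed away from the origin.
-/

/-- `c_d = |B(0,1)|`. -/
def unitBallVol (d : ℕ) : ℝ≥0∞ := volume (Metric.ball (0 : RSpace d) 1)

/-- `η(r) = (r / c_d)^{1/d}`, the radius of a ball of volume `r`. -/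
def ballRadius (d : ℕ) (r : ℝ≥0∞) : ℝ≥0∞ := (r / unitBallVol d) ^ (1 / (d : ℝ))

/-- The symmetric decreasing rearrangement `ν^*` as a function of the radius `ρ = |x|`:
`ν^*(ρ) = inf {s > 0 : |{ν > s}| ≤ c_d ρ^d}`. -/
def symmRearrangement {d : ℕ} (ν : RSpace d → ℝ≥0∞) (ρ : ℝ≥0∞) : ℝ≥0∞ :=
  sInf {s : ℝ≥0∞ | 0 < s ∧ volume {h : RSpace d | s < ν h} ≤ unitBallVol d * ρ ^ d}

/-- `ν^#(r) = ∫_{ν < ν^*(η(r))} ν(h) dh`. -/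
def rearrTail {d : ℕ} (ν : RSpace d → ℝ≥0∞) (r : ℝ≥0∞) : ℝ≥0∞ :=
  ∫⁻ h in {h : RSpace d | ν h < symmRearrangement ν (ballRadius d r)}, ν h

/-- `∫_{|h| ≥ η(r)} ν(h) dh`. -/
def ballTail {d : ℕ} (ν : RSpace d → ℝ≥0∞) (r : ℝ≥0∞) : ℝ≥0∞ :=
  ∫⁻ h in {h : RSpace d | ballRadius d r ≤ ‖h‖ₑ}, ν h

/-- `w(r) = (r T(r))^{1/p}` on `[0, ∞]`, where `T` is one of the two tails of a kernel, with the
convention `w(∞) = ∞` (and `w(0) = 0`, which holds because `0 * ∞ = 0`). -/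
def tailWeight (p : ℝ) (T : ℝ≥0∞ → ℝ≥0∞) (r : ℝ≥0∞) : ℝ≥0∞ :=
  if r = ∞ then ∞ else (r * T r) ^ (1 / p)

/-- `φ(t) = 1 / w⁻¹(1/t)`, for an invertible `w : [0, ∞] → [0, ∞]`. -/
def criticalOf (w : ℝ≥0∞ → ℝ≥0∞) (t : ℝ≥0∞) : ℝ≥0∞ := (Function.invFun w t⁻¹)⁻¹

/-- `ν` is radial and almost decreasing: `κ ν(x) ≤ ν(y)` whenever `|x| ≥ |y|`, for some
`0 < κ ≤ 1`. -/
def IsRadialAlmostDecreasing {d : ℕ} (ν : RSpace d → ℝ≥0∞) : Prop :=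
  (∀ x y : RSpace d, x ≠ 0 → y ≠ 0 → ‖x‖ = ‖y‖ → ν x = ν y) ∧
  ∃ κ : ℝ≥0, 0 < κ ∧ κ ≤ 1 ∧
    ∀ x y : RSpace d, x ≠ 0 → y ≠ 0 → ‖y‖ ≤ ‖x‖ → κ * ν x ≤ ν y

/-- `φ` is the critical function of `ν`: for a general measurable `ν` it is built from
`w(r) = (r ν^#(r))^{1/p}`; if `ν` is radial and almost decreasing, it may also be the one built
from `w(r) = (r ∫_{|h| ≥ η(r)} ν)^{1/p}`. In each case `w` has to be invertible on `[0, ∞]`. -/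
def IsCriticalFunction {d : ℕ} (p : ℝ) (ν : RSpace d → ℝ≥0∞) (φ : ℝ≥0∞ → ℝ≥0∞) : Prop :=
  (Function.Bijective (tailWeight p (rearrTail ν)) ∧
    φ = criticalOf (tailWeight p (rearrTail ν))) ∨
  (IsRadialAlmostDecreasing ν ∧ Function.Bijective (tailWeight p (ballTail ν)) ∧
    φ = criticalOf (tailWeight p (ballTail ν)))

/-- Growth condition with constant `θ`: `φ(t) φ(θ s/t) ≤ φ(s)` for all `s ≤ t`. -/
def GrowthCondition (φ : ℝ≥0∞ → ℝ≥0∞) (θ : ℝ≥0) : Prop :=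
  ∀ s t : ℝ≥0∞, s ≤ t → φ t * φ (θ * (s / t)) ≤ φ s

/-- `φ_min(t) = ∫_0^t min(φ₁(s), φ₂(s)) / s ds`. -/
def phiMin (φ₁ φ₂ : ℝ≥0∞ → ℝ≥0∞) (t : ℝ≥0∞) : ℝ≥0∞ :=
  ∫⁻ s in {s : ℝ | 0 < s ∧ ENNReal.ofReal s ≤ t},
    min (φ₁ (ENNReal.ofReal s)) (φ₂ (ENNReal.ofReal s)) / ENNReal.ofReal s

/-- `u ∈ L^φ(ℝ^d)`: `u` is (Lebesgue) measurable and `∫ φ(|u|/c) < ∞` for some `c > 0`. -/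
def MemOrlicz {d : ℕ} (φ : ℝ≥0∞ → ℝ≥0∞) (u : RSpace d → ℝ) : Prop :=
  AEMeasurable u volume ∧ ∃ c : ℝ≥0, 0 < c ∧ ∫⁻ x, φ (‖u x‖ₑ / c) < ∞

/-- The Luxemburg functional `inf {c > 0 : ∫ φ(|u|/c) ≤ 1}`, with value `∞` if there is no such
`c`. -/
def luxemburgNorm {d : ℕ} (φ : ℝ≥0∞ → ℝ≥0∞) (u : RSpace d → ℝ) : ℝ≥0∞ :=
  sInf {a : ℝ≥0∞ | ∃ c : ℝ≥0, 0 < c ∧ a = c ∧ ∫⁻ x, φ (‖u x‖ₑ / c) ≤ 1}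

/-- `|u|_{W^p_ν} = (∬ |u(x) - u(y)|^p ν(x - y) dy dx)^{1/p}`, possibly infinite. -/
def nonlocalSeminorm {d : ℕ} (p : ℝ) (ν : RSpace d → ℝ≥0∞) (u : RSpace d → ℝ) : ℝ≥0∞ :=
  (∫⁻ x, ∫⁻ y, ‖u x - u y‖ₑ ^ p * ν (x - y)) ^ (1 / p)

end

/-! Inverting `w` turns the definition of `φ` into the identity `t ^ p * T (1 / φ t) = φ t`, where
`T` is the tail of `ν`. By a bathtub argument this tail is, up to a constant, minimal among the
integrals of `ν` off sets of the same volume, so `κ φ(t) ≤ t ^ p ∫_{Fᶜ} ν` whenever `φ(t) |F| ≤ 1`.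
If `∫ φ(|u|/c) ≤ 1`, take `t = |u(x)|/(2c)` and `F = {|u|/c > t}`: Chebyshev gives `φ(t) |F| ≤ 1`,
and `|u(x) - u(y)| ≥ c t` off `F`. Integrating in `x` bounds `c ^ p ∫ φ(|u|/(2c))` by the energy
(`const_mul_lintegral_half_le`). Doubling makes this integral bounded below at a suitable dyadic `c`
(`exists_luxemburgNorm_le`). Only subhomogeneity (from convexity) and doubling (from the growth
condition) are needed, and both pass to `max` and `min`. Finally, `φ_min` is comparable to `min(φ₁,
φ₂)` up to constants and dilation. -/

/-! ### Bathtub principle and measures of level sets. -/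

section LevelSets

variable {α : Type*} [MeasurableSpace α] {μ : Measure α}

/-- Bathtub principle: among the sets of measure at most `μ Aᶜ`, removing `Aᶜ`, where `f` is
largest up to the factor `κ`, minimizes the remaining integral up to the factor `κ`. -/
lemma const_mul_setLIntegral_le_setLIntegral_compl {f : α → ℝ≥0∞} {A F : Set α} {m κ : ℝ≥0∞}
    (hA : NullMeasurableSet A μ) (hF : NullMeasurableSet F μ) (hFfin : μ F ≠ ∞)
    (hFA : μ F ≤ μ Aᶜ) (hκ : κ ≤ 1) (hκtop : κ ≠ ∞)
    (hle : ∀ᵐ x ∂μ, x ∈ A → κ * f x ≤ m) (hge : ∀ᵐ x ∂μ, x ∈ Aᶜ → m ≤ f x) :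
    κ * ∫⁻ x in A, f x ∂μ ≤ ∫⁻ x in Fᶜ, f x ∂μ := by
  -- Cancel the common part `Aᶜ ∩ F` in `μ F ≤ μ Aᶜ`; it has finite measure.
  have hmeas : μ (A ∩ F) ≤ μ (Aᶜ ∩ Fᶜ) := by
    have h1 : μ (F ∩ A) + μ (F \ A) = μ F := measure_inter_add_sdiff₀ F hA
    have h2 : μ (Aᶜ ∩ F) + μ (Aᶜ \ F) = μ Aᶜ := measure_inter_add_sdiff₀ Aᶜ hF
    have h3 : F \ A = Aᶜ ∩ F := by ext; simp [and_comm]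
    rw [← h1, ← h2, h3, add_comm, Set.inter_comm F A] at hFA
    have hfin : μ (Aᶜ ∩ F) ≠ ∞ := measure_ne_top_of_subset Set.inter_subset_right hFfin
    exact (ENNReal.add_le_add_iff_left hfin).1 hFA
  have hsplit : ∫⁻ x in A, f x ∂μ = ∫⁻ x in A ∩ F, f x ∂μ + ∫⁻ x in A \ F, f x ∂μ := by
    rw [← Measure.restrict_inter_add_sdiff₀ A hF, lintegral_add_measure]
  have hsplit' : ∫⁻ x in Fᶜ, f x ∂μ = ∫⁻ x in Fᶜ ∩ A, f x ∂μ + ∫⁻ x in Fᶜ \ A, f x ∂μ := by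
    rw [← Measure.restrict_inter_add_sdiff₀ Fᶜ hA, lintegral_add_measure]
  have e1 : Fᶜ ∩ A = A \ F := by ext; simp [and_comm]
  have e2 : Fᶜ \ A = Aᶜ ∩ Fᶜ := by ext; simp [and_comm]
  rw [hsplit, hsplit', e1, e2, mul_add, add_comm (∫⁻ x in A \ F, f x ∂μ)]
  refine add_le_add ?_ (mul_le_of_le_one_left zero_le hκ)
  calc κ * ∫⁻ x in A ∩ F, f x ∂μ = ∫⁻ x in A ∩ F, κ * f x ∂μ :=
        (lintegral_const_mul' κ f hκtop).symm
    _ ≤ ∫⁻ _ in A ∩ F, m ∂μ := by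
        refine lintegral_mono_ae ?_
        rw [ae_restrict_iff'₀ (hA.inter hF)]
        filter_upwards [hle] with x hx hxA using hx hxA.1
    _ = m * μ (A ∩ F) := setLIntegral_const _ _
    _ ≤ m * μ (Aᶜ ∩ Fᶜ) := by gcongr
    _ = ∫⁻ _ in Aᶜ ∩ Fᶜ, m ∂μ := (setLIntegral_const _ _).symm
    _ ≤ ∫⁻ x in Aᶜ ∩ Fᶜ, f x ∂μ := by
        refine lintegral_mono_ae ?_
        rw [ae_restrict_iff'₀ (hA.compl.inter hF.compl)]
        filter_upwards [hge] with x hx hxA using hx hxA.1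

/-- If all the level sets `{f > a}`, `0 < a < s`, have measure at least `r` and `f` is integrable
on `{f < s}`, then `{f ≥ s}` has measure at least `r`. -/
lemma le_measure_ge_of_forall_le_measure_gt {f : α → ℝ≥0∞} (hf : AEMeasurable f μ) {s r : ℝ≥0∞}
    (hs : s ≠ 0) (hr : ∀ a, 0 < a → a < s → r ≤ μ {x | a < f x})
    (hfin : ∫⁻ x in {x | f x < s}, f x ∂μ ≠ ∞) : r ≤ μ {x | s ≤ f x} := by
  by_cases htop : μ {x | s ≤ f x} = ∞
  · simp [htop]
  obtain ⟨a, ha_mono, ha_mem, ha_lim⟩ := exists_seq_strictMono_tendsto' (pos_iff_ne_zero.2 hs)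
  have hnull : ∀ b : ℝ≥0∞, NullMeasurableSet {x | b < f x} μ := fun b =>
    nullMeasurableSet_lt aemeasurable_const hf
  have hInter : {x | s ≤ f x} = ⋂ n, {x | a n < f x} := by
    ext x
    simp only [Set.mem_ofPred_eq, Set.mem_iInter]
    exact ⟨fun h n => (ha_mem n).2.trans_le h, fun h => le_of_tendsto' ha_lim fun n => (h n).le⟩
  -- Continuity from above needs one set of finite measure. Chebyshev on `{f < s}` provides it.
  have hfin0 : μ {x | a 0 < f x} ≠ ∞ := by
    have hsub : {x | a 0 < f x} ⊆ {x | s ≤ f x} ∪ {x | a 0 < f x ∧ f x < s} := fun x hx => by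
      rcases le_or_gt s (f x) with h | h
      exacts [Or.inl h, Or.inr ⟨hx, h⟩]
    have hmid : μ {x | a 0 < f x ∧ f x < s} ≠ ∞ := by
      have hlt : NullMeasurableSet {x | f x < s} μ := nullMeasurableSet_lt hf aemeasurable_const
      have hmidnull : NullMeasurableSet {x | a 0 < f x ∧ f x < s} μ := (hnull _).inter hlt
      have hmul : a 0 * μ {x | a 0 < f x ∧ f x < s} ≤ ∫⁻ x in {x | f x < s}, f x ∂μ := by
        calc a 0 * μ {x | a 0 < f x ∧ f x < s}
            = ∫⁻ _ in {x | a 0 < f x ∧ f x < s}, a 0 ∂μ := (setLIntegral_const _ _).symm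
          _ ≤ ∫⁻ x in {x | a 0 < f x ∧ f x < s}, f x ∂μ := by
              refine lintegral_mono_ae ?_
              rw [ae_restrict_iff'₀ hmidnull]
              exact Filter.Eventually.of_forall fun x hx => hx.1.le
          _ ≤ _ := lintegral_mono_set fun x hx => hx.2
      intro h
      rw [h, ENNReal.mul_top (ha_mem 0).1.ne', top_le_iff] at hmul
      exact hfin hmul
    exact ne_top_of_le_ne_top (ENNReal.add_ne_top.2 ⟨htop, hmid⟩)
      ((measure_mono hsub).trans (measure_union_le _ _))
  have hlim := tendsto_measure_iInter_atTop (μ := μ) (fun n => hnull (a n))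
    (fun m n hmn x (hx : a n < f x) => (ha_mono.monotone hmn).trans_lt hx) ⟨0, hfin0⟩
  rw [hInter]
  exact ge_of_tendsto' hlim fun n => hr _ (ha_mem n).1 (ha_mem n).2

end LevelSets

/-! ### Minimality of the two tails of a kernel. -/

section Tails

variable {d : ℕ} {ν : RSpace d → ℝ≥0∞}

lemma unitBallVol_ne_zero (d : ℕ) : unitBallVol d ≠ 0 :=
  (Metric.measure_ball_pos volume (0 : RSpace d) one_pos).ne'

lemma unitBallVol_ne_top (d : ℕ) : unitBallVol d ≠ ∞ := measure_ball_lt_top.ne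

lemma unitBallVol_mul_ballRadius_pow (hd : 1 ≤ d) (r : ℝ≥0∞) :
    unitBallVol d * ballRadius d r ^ d = r := by
  have hd' : (d : ℝ) ≠ 0 := by positivity
  rw [ballRadius, ← ENNReal.rpow_natCast, ← ENNReal.rpow_mul, one_div_mul_cancel hd',
    ENNReal.rpow_one, ENNReal.mul_div_cancel (unitBallVol_ne_zero d) (unitBallVol_ne_top d)]

lemma volume_norm_lt_ballRadius (hd : 1 ≤ d) {r : ℝ≥0∞} (hr : r ≠ ∞) :
    volume {h : RSpace d | ‖h‖ₑ < ballRadius d r} = r := by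
  have : Nonempty (Fin d) := ⟨⟨0, hd⟩⟩
  have hrad : ballRadius d r ≠ ∞ :=
    ENNReal.rpow_ne_top_of_nonneg (by positivity) (ENNReal.div_ne_top hr (unitBallVol_ne_zero d))
  have hset : {h : RSpace d | ‖h‖ₑ < ballRadius d r} = Metric.ball 0 (ballRadius d r).toReal := by
    ext h
    rw [Set.mem_ofPred_eq, mem_ball_zero_iff, ← ENNReal.toReal_lt_toReal enorm_ne_top hrad,
      toReal_enorm]
  rw [hset, Measure.addHaar_ball _ _ ENNReal.toReal_nonneg, finrank_euclideanSpace_fin, mul_comm,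
    ENNReal.ofReal_pow ENNReal.toReal_nonneg, ENNReal.ofReal_toReal hrad]
  exact unitBallVol_mul_ballRadius_pow hd r

/-- Bathtub at the level `s = ν^*(η(r))`. Levels below `s` are excluded from the infimum, so their
superlevel sets have volume above `r`; finiteness of the tail carries the bound `≥ r` to `{ν ≥ s}`.
-/
lemma rearrTail_le_setLIntegral_compl (hd : 1 ≤ d) (hν : AEMeasurable ν volume) {r : ℝ≥0∞}
    (hr : r ≠ ∞) (hT : rearrTail ν r ≠ ∞) {F : Set (RSpace d)}
    (hF : NullMeasurableSet F volume) (hFr : volume F ≤ r) :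
    rearrTail ν r ≤ ∫⁻ h in Fᶜ, ν h := by
  set s := symmRearrangement ν (ballRadius d r) with hs
  by_cases hs0 : s = 0
  · simp [rearrTail, ← hs, hs0]
  have hge : r ≤ volume {h | s ≤ ν h} := by
    refine le_measure_ge_of_forall_le_measure_gt hν hs0 (fun a ha has => ?_) hT
    by_contra hlt
    refine has.not_ge (sInf_le ⟨ha, ?_⟩)
    rw [unitBallVol_mul_ballRadius_pow hd]
    exact (not_le.1 hlt).le
  have hcompl : {h | ν h < s}ᶜ = {h | s ≤ ν h} := by ext; simp
  have := const_mul_setLIntegral_le_setLIntegral_compl (f := ν) (A := {h | ν h < s}) (m := s)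
    (κ := 1) (nullMeasurableSet_lt hν aemeasurable_const) hF (ne_top_of_le_ne_top hr hFr)
    (by rw [hcompl]; exact hFr.trans hge) le_rfl ENNReal.one_ne_top
    (Filter.Eventually.of_forall fun x hx => by simpa using le_of_lt hx)
    (Filter.Eventually.of_forall fun x hx => by simpa using hx)
  rwa [one_mul] at this

/-- Bathtub with the infimum of `ν` over the punctured ball as level: almost monotonicity puts `κ ν`
below it outside the ball. -/
lemma const_mul_ballTail_le_setLIntegral_compl (hd : 1 ≤ d) {κ : ℝ≥0} (hκ : κ ≤ 1)
    (hdec : ∀ x y : RSpace d, x ≠ 0 → y ≠ 0 → ‖y‖ ≤ ‖x‖ → κ * ν x ≤ ν y) {r : ℝ≥0∞}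
    (hr0 : r ≠ 0) (hr : r ≠ ∞) {F : Set (RSpace d)}
    (hF : NullMeasurableSet F volume) (hFr : volume F ≤ r) :
    κ * ballTail ν r ≤ ∫⁻ h in Fᶜ, ν h := by
  have : Nonempty (Fin d) := ⟨⟨0, hd⟩⟩
  have hrad : ballRadius d r ≠ 0 := fun h => by
    have := unitBallVol_mul_ballRadius_pow hd r
    rw [h, zero_pow (by omega), mul_zero] at this
    exact hr0 this.symm
  have hcompl : {h : RSpace d | ballRadius d r ≤ ‖h‖ₑ}ᶜ = {h | ‖h‖ₑ < ballRadius d r} := by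
    ext; simp
  have hne : ∀ᵐ x : RSpace d ∂volume, x ≠ 0 := by simp [ae_iff]
  refine const_mul_setLIntegral_le_setLIntegral_compl
    (m := ⨅ y : {y : RSpace d // y ≠ 0 ∧ ‖y‖ₑ < ballRadius d r}, ν y)
    (measurableSet_le measurable_const measurable_enorm).nullMeasurableSet hF
    (ne_top_of_le_ne_top hr hFr) (by rwa [hcompl, volume_norm_lt_ballRadius hd hr])
    (by exact_mod_cast hκ) ENNReal.coe_ne_top (Filter.Eventually.of_forall fun x hx => ?_) ?_
  · refine le_iInf fun y => hdec x y ?_ y.2.1 ?_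
    · rintro rfl
      simp only [Set.mem_ofPred_eq, enorm_zero, nonpos_iff_eq_zero] at hx
      exact hrad hx
    · exact enorm_le_iff_norm_le.1 (y.2.2.le.trans hx)
  · filter_upwards [hne] with x hx0 hx
    rw [hcompl] at hx
    exact iInf_le (fun y : {y : RSpace d // y ≠ 0 ∧ ‖y‖ₑ < ballRadius d r} => ν y) ⟨x, hx0, hx⟩

end Tails

/-! ### The identity defining a critical function and the resulting lower bound on tails. -/

section CriticalFunctions

variable {d : ℕ} {p : ℝ} {ν : RSpace d → ℝ≥0∞} {φ : ℝ≥0∞ → ℝ≥0∞} {T : ℝ≥0∞ → ℝ≥0∞}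

lemma tailWeight_zero (hp : 0 < p) : tailWeight p T 0 = 0 := by
  simp [tailWeight, hp]

lemma tailWeight_top : tailWeight p T ∞ = ∞ := by simp [tailWeight]

lemma tailWeight_criticalOf (hT : Function.Bijective (tailWeight p T)) (t : ℝ≥0∞) :
    tailWeight p T (criticalOf (tailWeight p T) t)⁻¹ = t⁻¹ := by
  rw [criticalOf, inv_inv, Function.invFun_eq (hT.2 _)]

lemma criticalOf_eq_zero_iff (hT : Function.Bijective (tailWeight p T)) {t : ℝ≥0∞} :
    criticalOf (tailWeight p T) t = 0 ↔ t = 0 := by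
  rw [← ENNReal.inv_eq_top, ← hT.1.eq_iff, tailWeight_criticalOf hT, tailWeight_top,
    ENNReal.inv_eq_top]

lemma criticalOf_eq_top_iff (hp : 0 < p) (hT : Function.Bijective (tailWeight p T)) {t : ℝ≥0∞} :
    criticalOf (tailWeight p T) t = ∞ ↔ t = ∞ := by
  rw [← ENNReal.inv_eq_zero, ← hT.1.eq_iff, tailWeight_criticalOf hT, tailWeight_zero hp,
    ENNReal.inv_eq_zero]

lemma IsCriticalFunction.eq_zero_iff (h : IsCriticalFunction p ν φ) {t : ℝ≥0∞} :
    φ t = 0 ↔ t = 0 := by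
  rcases h with ⟨hT, rfl⟩ | ⟨-, hT, rfl⟩ <;> exact criticalOf_eq_zero_iff hT

lemma IsCriticalFunction.eq_top_iff (hp : 0 < p) (h : IsCriticalFunction p ν φ) {t : ℝ≥0∞} :
    φ t = ∞ ↔ t = ∞ := by
  rcases h with ⟨hT, rfl⟩ | ⟨-, hT, rfl⟩ <;> exact criticalOf_eq_top_iff hp hT

lemma rpow_mul_tail_criticalOf (hp : 0 < p) (hT : Function.Bijective (tailWeight p T))
    {t : ℝ≥0∞} (ht0 : t ≠ 0) (ht : t ≠ ∞) :
    t ^ p * T (criticalOf (tailWeight p T) t)⁻¹ = criticalOf (tailWeight p T) t := by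
  have hw := tailWeight_criticalOf hT t
  have h0 := (criticalOf_eq_zero_iff hT).not.2 ht0
  have htop := (criticalOf_eq_top_iff hp hT).not.2 ht
  generalize criticalOf (tailWeight p T) t = a at *
  rw [tailWeight, if_neg (ENNReal.inv_ne_top.2 h0)] at hw
  have hw' : a⁻¹ * T a⁻¹ = (t ^ p)⁻¹ := by
    rw [← ENNReal.inv_rpow, ← hw, ← ENNReal.rpow_mul, one_div_mul_cancel hp.ne', ENNReal.rpow_one]
  have htp0 : t ^ p ≠ 0 := by simp [ENNReal.rpow_eq_zero_iff, ht0, ht]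
  have htp : t ^ p ≠ ∞ := ENNReal.rpow_ne_top_of_nonneg hp.le ht
  calc t ^ p * T a⁻¹ = t ^ p * (a * a⁻¹ * T a⁻¹) := by rw [ENNReal.mul_inv_cancel h0 htop, one_mul]
    _ = t ^ p * (t ^ p)⁻¹ * a := by rw [← hw']; ring
    _ = a := by rw [ENNReal.mul_inv_cancel htp0 htp, one_mul]

lemma IsCriticalFunction.exists_const_mul_le (hd : 1 ≤ d) (hp : 0 < p)
    (hν : AEMeasurable ν volume) (h : IsCriticalFunction p ν φ) :
    ∃ κ : ℝ≥0, 0 < κ ∧ ∀ t : ℝ≥0∞, t ≠ 0 → t ≠ ∞ → ∀ F : Set (RSpace d),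
      NullMeasurableSet F volume → φ t * volume F ≤ 1 → κ * φ t ≤ t ^ p * ∫⁻ h in Fᶜ, ν h := by
  have hvol : ∀ {t : ℝ≥0∞} {F : Set (RSpace d)}, t ≠ 0 → t ≠ ∞ → φ t * volume F ≤ 1 →
      volume F ≤ (φ t)⁻¹ := fun {t F} ht0 ht hle => by
    rw [ENNReal.le_inv_iff_mul_le, mul_comm]
    exact hle
  have hinv0 : ∀ {t : ℝ≥0∞}, t ≠ ∞ → (φ t)⁻¹ ≠ 0 := fun {t} ht =>
    ENNReal.inv_ne_zero.2 ((h.eq_top_iff hp).not.2 ht)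
  have hinv : ∀ {t : ℝ≥0∞}, t ≠ 0 → (φ t)⁻¹ ≠ ∞ := fun {t} ht =>
    ENNReal.inv_ne_top.2 (h.eq_zero_iff.not.2 ht)
  rcases h with ⟨hT, hφ⟩ | ⟨⟨-, κ, hκ0, hκ, hdec⟩, hT, hφ⟩
  · refine ⟨1, one_pos, fun t ht0 ht F hF hle => ?_⟩
    have heq : t ^ p * rearrTail ν (φ t)⁻¹ = φ t := by
      rw [hφ]; exact rpow_mul_tail_criticalOf hp hT ht0 ht
    -- An infinite tail would give `w = ∞` at a finite radius, against injectivity, since `w(∞) =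
    -- ∞`.
    have hne : rearrTail ν (φ t)⁻¹ ≠ ∞ := fun htop => by
      have h1 := hinv ht0
      have h2 := hT.1.ne h1
      rw [tailWeight_top, tailWeight, if_neg h1, htop, ENNReal.mul_top (hinv0 ht),
        ENNReal.top_rpow_of_pos (by positivity)] at h2
      exact h2 rfl
    rw [ENNReal.coe_one, one_mul]
    nth_rewrite 1 [← heq]
    gcongr
    exact rearrTail_le_setLIntegral_compl hd hν (hinv ht0) hne hF (hvol ht0 ht hle)
  · refine ⟨κ, hκ0, fun t ht0 ht F hF hle => ?_⟩
    have heq : t ^ p * ballTail ν (φ t)⁻¹ = φ t := by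
      rw [hφ]; exact rpow_mul_tail_criticalOf hp hT ht0 ht
    nth_rewrite 1 [← heq]
    rw [mul_left_comm]
    gcongr
    exact const_mul_ballTail_le_setLIntegral_compl hd hκ hdec (hinv0 ht) (hinv ht0) hF
      (hvol ht0 ht hle)

end CriticalFunctions

/-! ### Subhomogeneity, doubling and `φ_min`. -/

section OrliczFunctions

variable {p : ℝ} {φ φ₁ φ₂ : ℝ≥0∞ → ℝ≥0∞}

/-- `φ(a t) ≤ a φ(t)` for `a ≤ 1`. -/
def IsSubhomogeneous (φ : ℝ≥0∞ → ℝ≥0∞) : Prop :=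
  ∀ (a : ℝ≥0) (t : ℝ≥0∞), a ≤ 1 → φ (a * t) ≤ a * φ t

/-- The `Δ₂` condition with constant `K`. -/
def IsDoubling (φ : ℝ≥0∞ → ℝ≥0∞) (K : ℝ≥0) : Prop := ∀ t : ℝ≥0∞, φ t ≤ K * φ (t / 2)

/-- Convexity between `0` and `t ^ p` with weight `a ^ p` gives `φ(a t) ≤ a ^ p φ(t)`, and `a ^ p ≤
a`. -/
lemma IsSubhomogeneous.of_convexOn (hp : 1 ≤ p) (h0 : φ 0 = 0)
    (h : ConvexOn ℝ≥0 Set.univ (fun t : ℝ≥0∞ => φ (t ^ (1 / p)))) : IsSubhomogeneous φ := by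
  intro a t ha
  have hp0 : 0 < p := by linarith
  have hap : a ^ p ≤ a :=
    NNReal.rpow_le_self_of_le_one ha hp
  have hap1 : a ^ p ≤ 1 := hap.trans ha
  have key := h.2 (Set.mem_univ (t ^ p)) (Set.mem_univ 0) zero_le
    zero_le (add_tsub_cancel_of_le hap1)
  simp only [smul_zero, add_zero, ENNReal.smul_def, smul_eq_mul] at key
  rw [ENNReal.zero_rpow_of_pos (by positivity), h0, mul_zero, add_zero,
    ENNReal.coe_rpow_of_nonneg _ hp0.le, ← ENNReal.mul_rpow_of_nonneg _ _ hp0.le,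
    ← ENNReal.rpow_mul, ← ENNReal.rpow_mul, mul_one_div_cancel hp0.ne', ENNReal.rpow_one,
    ENNReal.rpow_one] at key
  refine key.trans ?_
  rw [← ENNReal.coe_rpow_of_nonneg _ hp0.le]
  gcongr

lemma IsSubhomogeneous.monotone (h : IsSubhomogeneous φ) (htop : φ ∞ = ∞) : Monotone φ := by
  intro s t hst
  by_cases ht : t = ∞
  · simp [ht, htop]
  rcases eq_or_ne t 0 with rfl | ht0
  · rw [nonpos_iff_eq_zero.1 hst]
  have hle : s / t ≤ 1 := ENNReal.div_le_of_le_mul (by simpa using hst)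
  lift s / t to ℝ≥0 using ne_top_of_le_ne_top ENNReal.one_ne_top hle with a ha
  have hst' : (a : ℝ≥0∞) * t = s := by rw [ha, ENNReal.div_mul_cancel ht0 ht]
  have ha1 : a ≤ 1 := by exact_mod_cast hle
  calc φ s = φ (a * t) := by rw [hst']
    _ ≤ a * φ t := h a t ha1
    _ ≤ φ t := mul_le_of_le_one_left zero_le hle

lemma IsSubhomogeneous.max (h₁ : IsSubhomogeneous φ₁) (h₂ : IsSubhomogeneous φ₂) :
    IsSubhomogeneous fun t => max (φ₁ t) (φ₂ t) := fun a t ha =>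
  max_le ((h₁ a t ha).trans (by gcongr; exact le_max_left _ _))
    ((h₂ a t ha).trans (by gcongr; exact le_max_right _ _))

lemma IsSubhomogeneous.min (h₁ : IsSubhomogeneous φ₁) (h₂ : IsSubhomogeneous φ₂) :
    IsSubhomogeneous fun t => min (φ₁ t) (φ₂ t) := fun a t ha => by
  rcases le_total (φ₁ t) (φ₂ t) with h | h
  · simpa only [min_eq_left h] using (min_le_left _ _).trans (h₁ a t ha)
  · simpa only [min_eq_right h] using (min_le_right _ _).trans (h₂ a t ha)

/-- Taking `s = t/2` in the growth condition gives `K = 1 / φ(θ/2)`. -/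
lemma GrowthCondition.exists_isDoubling {θ : ℝ≥0} (h : GrowthCondition φ θ) (hθ : 0 < θ)
    (h0 : ∀ {t}, φ t = 0 ↔ t = 0) (htop : ∀ {t}, φ t = ∞ ↔ t = ∞) :
    ∃ K : ℝ≥0, IsDoubling φ K := by
  set b : ℝ≥0∞ := θ * 2⁻¹ with hb
  have hb0 : b ≠ 0 := mul_ne_zero (by exact_mod_cast hθ.ne') (by simp)
  have hbtop : b ≠ ∞ := ENNReal.mul_ne_top ENNReal.coe_ne_top (by simp)
  have hφ0 : φ b ≠ 0 := h0.not.2 hb0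
  have hφtop : φ b ≠ ∞ := htop.not.2 hbtop
  refine ⟨(φ b)⁻¹.toNNReal, fun t => ?_⟩
  rw [ENNReal.coe_toNNReal (ENNReal.inv_ne_top.2 hφ0)]
  rcases eq_or_ne t 0 with rfl | ht0
  · rw [h0.2 rfl]
    exact zero_le
  rcases eq_or_ne t ∞ with rfl | httop
  · rw [ENNReal.top_div_of_ne_top ENNReal.ofNat_ne_top, htop.2 rfl,
      ENNReal.mul_top (ENNReal.inv_ne_zero.2 hφtop)]
  have key := h (t / 2) t ENNReal.half_le_self
  have hdiv : t / 2 / t = 2⁻¹ := by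
    rw [div_eq_mul_inv, div_eq_mul_inv, mul_right_comm, ENNReal.mul_inv_cancel ht0 httop, one_mul]
  rw [hdiv, ← hb] at key
  calc φ t = (φ b)⁻¹ * (φ t * φ b) := by
        rw [mul_left_comm, ENNReal.inv_mul_cancel hφ0 hφtop, mul_one]
    _ ≤ _ := by gcongr

lemma IsDoubling.mono {K L : ℝ≥0} (h : IsDoubling φ K) (hKL : K ≤ L) : IsDoubling φ L :=
  fun t => (h t).trans (by gcongr)

lemma IsDoubling.max {K : ℝ≥0} (h₁ : IsDoubling φ₁ K) (h₂ : IsDoubling φ₂ K) :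
    IsDoubling (fun t => max (φ₁ t) (φ₂ t)) K := fun t =>
  max_le ((h₁ t).trans (by gcongr; exact le_max_left _ _))
    ((h₂ t).trans (by gcongr; exact le_max_right _ _))

lemma IsDoubling.min {K : ℝ≥0} (h₁ : IsDoubling φ₁ K) (h₂ : IsDoubling φ₂ K) :
    IsDoubling (fun t => min (φ₁ t) (φ₂ t)) K := fun t => by
  rcases le_total (φ₁ (t / 2)) (φ₂ (t / 2)) with h | h
  · simpa only [min_eq_left h] using (min_le_left _ _).trans (h₁ t)
  · simpa only [min_eq_right h] using (min_le_right _ _).trans (h₂ t)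

lemma IsDoubling.le_pow_mul {K : ℝ≥0} (h : IsDoubling φ K) (n : ℕ) (t : ℝ≥0∞) :
    φ t ≤ K ^ n * φ (t / 2 ^ n) := by
  induction n with
  | zero => simp
  | succ n ih =>
    refine ih.trans ?_
    rw [pow_succ (K : ℝ≥0∞), mul_assoc]
    gcongr
    refine (h _).trans_eq ?_
    rw [div_eq_mul_inv, div_eq_mul_inv, div_eq_mul_inv, mul_assoc, pow_succ,
      ENNReal.mul_inv (by simp) (by simp)]

/-- By subhomogeneity the integrand on `(0, t]` is at most its value at `t`. -/
lemma phiMin_le (h : IsSubhomogeneous fun t => min (φ₁ t) (φ₂ t))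
    (htop : min (φ₁ ∞) (φ₂ ∞) = ∞) (t : ℝ≥0∞) : phiMin φ₁ φ₂ t ≤ min (φ₁ t) (φ₂ t) := by
  by_cases ht : t = ∞
  · rw [ht, htop]; exact le_top
  rcases eq_or_ne t 0 with rfl | ht0
  · have : {s : ℝ | 0 < s ∧ ENNReal.ofReal s ≤ 0} = ∅ := by
      ext s
      simp +contextual [not_le]
    rw [phiMin, this, Measure.restrict_empty, lintegral_zero_measure]
    exact zero_le
  have hset : {s : ℝ | 0 < s ∧ ENNReal.ofReal s ≤ t} = Set.Ioc 0 t.toReal := by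
    ext s
    simp [ENNReal.ofReal_le_iff_le_toReal ht]
  rw [phiMin, hset]
  set m := min (φ₁ t) (φ₂ t) with hm
  calc ∫⁻ s in Set.Ioc 0 t.toReal,
        min (φ₁ (ENNReal.ofReal s)) (φ₂ (ENNReal.ofReal s)) / ENNReal.ofReal s
      ≤ ∫⁻ _ in Set.Ioc 0 t.toReal, m / t := by
        refine setLIntegral_mono' measurableSet_Ioc fun s hs => ?_
        have hs0 : ENNReal.ofReal s ≠ 0 := by simpa using hs.1
        have hst : ENNReal.ofReal s ≤ t := (ENNReal.ofReal_le_iff_le_toReal ht).2 hs.2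
        have hle : ENNReal.ofReal s / t ≤ 1 := ENNReal.div_le_of_le_mul (by simpa using hst)
        obtain ⟨a, ha⟩ := ENNReal.canLift.prf _ (ne_top_of_le_ne_top ENNReal.one_ne_top hle)
        have hst' : (a : ℝ≥0∞) * t = ENNReal.ofReal s := by
          rw [ha, ENNReal.div_mul_cancel ht0 ht]
        have key := h a t (by rw [← ha] at hle; exact_mod_cast hle)
        simp only [hst'] at key
        refine ENNReal.div_le_of_le_mul (key.trans_eq ?_)
        rw [← hm, ha, div_eq_mul_inv, div_eq_mul_inv]
        ring
    _ = m / t * t := by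
        rw [setLIntegral_const, Real.volume_Ioc, sub_zero, ENNReal.ofReal_toReal ht]
    _ = m := ENNReal.div_mul_cancel ht0 ht

/-- Keep only `(t/2, t]`, of length `t/2`, where monotonicity bounds the integrand below by `min(φ₁,
φ₂)(t/2) / t`. -/
lemma le_two_mul_phiMin (hmono : Monotone fun t => min (φ₁ t) (φ₂ t))
    (h0 : min (φ₁ 0) (φ₂ 0) = 0) {t : ℝ≥0∞} (ht : t ≠ ∞) :
    min (φ₁ (t / 2)) (φ₂ (t / 2)) ≤ 2 * phiMin φ₁ φ₂ t := by
  rcases eq_or_ne t 0 with rfl | ht0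
  · simp [h0]
  set m := min (φ₁ (t / 2)) (φ₂ (t / 2)) with hm
  have hpos : 0 < t.toReal := ENNReal.toReal_pos ht0 ht
  have key : m / t * (t / 2) ≤ phiMin φ₁ φ₂ t :=
    calc m / t * (t / 2) = ∫⁻ _ in Set.Ioc (t.toReal / 2) t.toReal, m / t := by
          rw [setLIntegral_const, Real.volume_Ioc, sub_half, ENNReal.ofReal_div_of_pos two_pos,
            ENNReal.ofReal_toReal ht, ENNReal.ofReal_ofNat]
      _ ≤ ∫⁻ s in Set.Ioc (t.toReal / 2) t.toReal,
          min (φ₁ (ENNReal.ofReal s)) (φ₂ (ENNReal.ofReal s)) / ENNReal.ofReal s := by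
          refine setLIntegral_mono' measurableSet_Ioc fun s hs => ?_
          refine ENNReal.div_le_div ?_ ((ENNReal.ofReal_le_iff_le_toReal ht).2 hs.2)
          refine hmono ?_
          rw [ENNReal.le_ofReal_iff_toReal_le (ENNReal.div_ne_top ht two_ne_zero)
            (by linarith [hs.1]), ENNReal.toReal_div]
          exact hs.1.le
      _ ≤ phiMin φ₁ φ₂ t := lintegral_mono_set fun s hs =>
          ⟨by linarith [hs.1], (ENNReal.ofReal_le_iff_le_toReal ht).2 hs.2⟩
  calc m = 2 * (m / t * (t / 2)) := by
        rw [← mul_div_assoc, ENNReal.div_mul_cancel ht0 ht,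
          ENNReal.mul_div_cancel two_ne_zero ENNReal.ofNat_ne_top]
    _ ≤ _ := by gcongr

end OrliczFunctions

/-! ### The Sobolev inequality for one critical function, then the main theorem. -/

section SobolevInequality

variable {d : ℕ} {p : ℝ} {ν : RSpace d → ℝ≥0∞} {φ : ℝ≥0∞ → ℝ≥0∞} {u : RSpace d → ℝ} {κ K : ℝ≥0}

lemma const_mul_lintegral_half_le (hp : 0 < p) (hmono : Monotone φ) (h0 : φ 0 = 0)
    (hκ : ∀ t : ℝ≥0∞, t ≠ 0 → t ≠ ∞ → ∀ F : Set (RSpace d),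
      NullMeasurableSet F volume → φ t * volume F ≤ 1 → κ * φ t ≤ t ^ p * ∫⁻ h in Fᶜ, ν h)
    (hu : AEMeasurable u volume) {c : ℝ≥0} (hc : 0 < c) (hI : ∫⁻ x, φ (‖u x‖ₑ / c) ≤ 1) :
    (c : ℝ≥0∞) ^ p * (κ * ∫⁻ x, φ (‖u x‖ₑ / c / 2)) ≤
      ∫⁻ x, ∫⁻ y, ‖u x - u y‖ₑ ^ p * ν (x - y) := by
  have hc0 : (c : ℝ≥0∞) ≠ 0 := by exact_mod_cast hc.ne'
  have hmeas : AEMeasurable (fun y => ‖u y‖ₑ / (c : ℝ≥0∞)) volume := hu.enorm.div_const _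
  have hcp : (c : ℝ≥0∞) ^ p ≠ ∞ := ENNReal.rpow_ne_top_of_nonneg hp.le ENNReal.coe_ne_top
  rw [← lintegral_const_mul' _ _ ENNReal.coe_ne_top, ← lintegral_const_mul' _ _ hcp]
  refine lintegral_mono fun x => ?_
  set t := ‖u x‖ₑ / c / 2 with ht
  rcases eq_or_ne t 0 with ht0 | ht0
  · simp [ht0, h0]
  have httop : t ≠ ∞ := ENNReal.div_ne_top (ENNReal.div_ne_top enorm_ne_top hc0) two_ne_zero
  set F : Set (RSpace d) := {y | t < ‖u y‖ₑ / c} with hFdef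
  have hF : NullMeasurableSet F volume := nullMeasurableSet_lt aemeasurable_const hmeas
  have hvolF : φ t * volume F ≤ 1 := by
    refine le_trans ?_ hI
    refine le_trans ?_ (mul_meas_ge_le_lintegral₀ (hmono.measurable.comp_aemeasurable hmeas) (φ t))
    gcongr
    exact fun y hy => hmono (le_of_lt hy)
  -- The tail bound lives in the variable `h = x - y`, so `F` is reflected and translated, keeping
  -- its volume.
  have hqmp : Measure.QuasiMeasurePreserving (fun h : RSpace d => x - h) volume volume :=
    (Measure.measurePreserving_sub_left volume x).quasiMeasurePreserving
  set G : Set (RSpace d) := (fun h => x - h) ⁻¹' F with hG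
  have hGnull : NullMeasurableSet G volume := hF.preimage hqmp
  have hvolG : volume G = volume F :=
    (Measure.measurePreserving_sub_left volume x).measure_preimage hF
  have key := hκ t ht0 httop G hGnull (by rwa [hvolG])
  calc (c : ℝ≥0∞) ^ p * (κ * φ t) ≤ (c : ℝ≥0∞) ^ p * (t ^ p * ∫⁻ h in Gᶜ, ν h) := by gcongr
    _ = ∫⁻ h in Gᶜ, (c * t) ^ p * ν h := by
        rw [lintegral_const_mul' _ _ (ENNReal.rpow_ne_top_of_nonneg hp.le
          (ENNReal.mul_ne_top ENNReal.coe_ne_top httop)), ENNReal.mul_rpow_of_nonneg _ _ hp.le,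
          mul_assoc]
    _ ≤ ∫⁻ h in Gᶜ, ‖u x - u (x - h)‖ₑ ^ p * ν h := by
        refine lintegral_mono_ae ?_
        rw [ae_restrict_iff'₀ hGnull.compl]
        refine Filter.Eventually.of_forall fun h hh => ?_
        gcongr
        have hle : ‖u (x - h)‖ₑ / c ≤ t := not_lt.1 hh
        have hle' : ‖u (x - h)‖ₑ ≤ c * t := by
          rw [ENNReal.div_le_iff hc0 ENNReal.coe_ne_top] at hle
          rwa [mul_comm]
        have hux : ‖u x‖ₑ = c * t + c * t := by
          rw [← mul_add, ht, ENNReal.add_halves, ENNReal.mul_div_cancel hc0 ENNReal.coe_ne_top]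
        have htri : c * t + c * t ≤ ‖u x - u (x - h)‖ₑ + c * t := by
          rw [← hux]
          calc ‖u x‖ₑ = ‖(u x - u (x - h)) + u (x - h)‖ₑ := by rw [sub_add_cancel]
            _ ≤ ‖u x - u (x - h)‖ₑ + ‖u (x - h)‖ₑ := enorm_add_le _ _
            _ ≤ _ := by gcongr
        exact (ENNReal.add_le_add_iff_right
          (ENNReal.mul_ne_top ENNReal.coe_ne_top httop)).1 htri
    _ ≤ ∫⁻ h, ‖u x - u (x - h)‖ₑ ^ p * ν h := setLIntegral_le_lintegral _ _
    _ = ∫⁻ y, ‖u x - u y‖ₑ ^ p * ν (x - y) := by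
        rw [← lintegral_sub_left_eq_self (fun y => ‖u x - u y‖ₑ ^ p * ν (x - y)) x]
        simp

/-- Under doubling, finiteness at one scale passes to every scale. -/
lemma lintegral_div_lt_top (hmono : Monotone φ) (hK : IsDoubling φ K) (hu : MemOrlicz φ u)
    {c : ℝ≥0} (hc : 0 < c) : ∫⁻ x, φ (‖u x‖ₑ / c) < ∞ := by
  obtain ⟨-, b, hb, hfin⟩ := hu
  obtain ⟨n, hn⟩ := exists_nat_gt (b / c)
  have hbc : b ≤ c * 2 ^ n := by
    have h2 : (n : ℝ≥0) ≤ 2 ^ n := by exact_mod_cast n.lt_two_pow_self.le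
    rw [div_lt_iff₀ hc] at hn
    refine hn.le.trans ?_
    rw [mul_comm]
    gcongr
  calc ∫⁻ x, φ (‖u x‖ₑ / c) ≤ ∫⁻ x, K ^ n * φ (‖u x‖ₑ / b) := by
        refine lintegral_mono fun x => (hK.le_pow_mul n _).trans ?_
        gcongr
        refine hmono ?_
        rw [div_eq_mul_inv, div_eq_mul_inv, div_eq_mul_inv, mul_assoc,
          ← ENNReal.mul_inv (by simp) (by simp)]
        gcongr
        exact_mod_cast hbc
    _ = K ^ n * ∫⁻ x, φ (‖u x‖ₑ / b) :=
        lintegral_const_mul' _ _ (ENNReal.pow_ne_top ENNReal.coe_ne_top)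
    _ < ∞ := ENNReal.mul_lt_top (ENNReal.pow_lt_top ENNReal.coe_lt_top) hfin

/-- The Sobolev inequality for a monotone, subhomogeneous and doubling critical function. -/
theorem exists_luxemburgNorm_le (hd : 1 ≤ d) (hp : 0 < p) (hν : AEMeasurable ν volume)
    (hφ : IsCriticalFunction p ν φ) (hsub : IsSubhomogeneous φ) (hK : IsDoubling φ K) :
    ∃ C : ℝ≥0, 0 < C ∧ ∀ u : RSpace d → ℝ, MemOrlicz φ u →
      luxemburgNorm φ u ≤ C * nonlocalSeminorm p ν u := by
  obtain ⟨κ, hκ0, hκ⟩ := hφ.exists_const_mul_le hd hp hν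
  have h0 : φ 0 = 0 := hφ.eq_zero_iff.2 rfl
  have hmono : Monotone φ := hsub.monotone ((hφ.eq_top_iff hp).2 rfl)
  have hKpos : 0 < K := by
    rcases eq_or_ne K 0 with rfl | h
    · have := hK 1
      rw [ENNReal.coe_zero, zero_mul, nonpos_iff_eq_zero, hφ.eq_zero_iff] at this
      exact absurd this one_ne_zero
    · exact pos_iff_ne_zero.2 h
  refine ⟨(K ^ 2 / κ) ^ (1 / p), NNReal.rpow_pos (by positivity), fun u hu => ?_⟩
  set E := ∫⁻ x, ∫⁻ y, ‖u x - u y‖ₑ ^ p * ν (x - y) with hE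
  -- It suffices that every `c` above the claimed bound is admissible; an inadmissible `c` is shown
  -- to lie below that bound.
  refine le_of_forall_gt_imp_ge_of_dense fun c hc => ?_
  by_cases hctop : c = ∞
  · rw [hctop]
    exact le_top
  lift c to ℝ≥0 using hctop
  have hcpos : 0 < c := by exact_mod_cast pos_of_gt hc
  refine sInf_le ⟨c, hcpos, rfl, ?_⟩
  by_contra hgt
  set I : ℕ → ℝ≥0∞ := fun n => ∫⁻ x, φ (‖u x‖ₑ / (c * 2 ^ n : ℝ≥0)) with hI
  have hdiv : ∀ (n : ℕ) (x : RSpace d),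
      ‖u x‖ₑ / (c * 2 ^ n : ℝ≥0) = ‖u x‖ₑ / c / 2 ^ n := fun n x => by
    rw [div_eq_mul_inv, div_eq_mul_inv, div_eq_mul_inv, mul_assoc,
      ← ENNReal.mul_inv (by simp) (by simp)]
    push_cast
    rfl
  have hIle : ∀ n, I n ≤ 2⁻¹ ^ n * ∫⁻ x, φ (‖u x‖ₑ / c) := fun n => by
    rw [← lintegral_const_mul' _ _ (by simp)]
    refine lintegral_mono fun x => ?_
    have key := hsub (2⁻¹ ^ n) (‖u x‖ₑ / c) (pow_le_one₀ zero_le (by norm_num))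
    rw [hdiv, div_eq_mul_inv _ (2 ^ n : ℝ≥0∞), mul_comm, ← ENNReal.inv_pow]
    simpa using key
  have hex : ∃ n, I n ≤ 1 := by
    have hfin : ∫⁻ x, φ (‖u x‖ₑ / c) ≠ ∞ := (lintegral_div_lt_top hmono hK hu hcpos).ne
    obtain ⟨n, hn⟩ := ENNReal.exists_inv_two_pow_lt (ENNReal.inv_ne_zero.2 hfin)
    exact ⟨n, (hIle n).trans (ENNReal.le_inv_iff_mul_le.1 hn.le)⟩
  -- At the first dyadic scale with modular at most `1`, the energy estimate applies, while the
  -- preceding scale still has modular above `1`.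
  obtain ⟨m, hm⟩ : ∃ m, Nat.find hex = m + 1 := Nat.exists_eq_succ_of_ne_zero fun h => by
    have := Nat.find_spec hex
    rw [h] at this
    exact hgt (by simpa [hI] using this)
  have hm1 : 1 < I m := not_le.1 (Nat.find_min hex (by omega))
  have hm2 : I (m + 1) ≤ 1 := hm ▸ Nat.find_spec hex
  set b : ℝ≥0 := c * 2 ^ (m + 1) with hb
  set J := ∫⁻ x, φ (‖u x‖ₑ / b / 2) with hJ
  have hmain : (b : ℝ≥0∞) ^ p * (κ * J) ≤ E :=
    const_mul_lintegral_half_le hp hmono h0 hκ hu.1 (by positivity) hm2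
  -- Two doublings: `J` is taken at scale `2 b = 4 (c * 2 ^ m)`.
  have hIJ : I m ≤ K ^ 2 * J := by
    rw [hJ, ← lintegral_const_mul' _ _ (ENNReal.pow_ne_top ENNReal.coe_ne_top)]
    refine lintegral_mono fun x => (hK.le_pow_mul 2 _).trans_eq ?_
    congr 2
    rw [hdiv, hb, hdiv, pow_succ _ m]
    simp only [div_eq_mul_inv]
    rw [ENNReal.mul_inv (by simp) (by simp), ENNReal.inv_pow (n := 2)]
    ring
  have hcb : (c : ℝ≥0∞) ≤ b := by
    rw [hb]
    exact_mod_cast le_mul_of_one_le_right (zero_le (a := c)) (one_le_pow₀ one_le_two)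
  have hcE : (c : ℝ≥0∞) ^ p * κ ≤ K ^ 2 * E :=
    calc (c : ℝ≥0∞) ^ p * κ ≤ (b : ℝ≥0∞) ^ p * κ * (K ^ 2 * J) := by
          rw [← mul_one ((c : ℝ≥0∞) ^ p * κ)]
          gcongr
          exact hm1.le.trans hIJ
      _ = K ^ 2 * ((b : ℝ≥0∞) ^ p * (κ * J)) := by ring
      _ ≤ K ^ 2 * E := by gcongr
  have hle : (c : ℝ≥0∞) ≤ ((K ^ 2 / κ : ℝ≥0) * E) ^ (1 / p) := by
    rw [one_div, ENNReal.le_rpow_inv_iff hp, ENNReal.coe_div hκ0.ne', div_eq_mul_inv,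
      mul_right_comm, ← div_eq_mul_inv, ENNReal.le_div_iff_mul_le (by simp [hκ0.ne']) (by simp)]
    exact_mod_cast hcE
  refine hc.not_ge (hle.trans_eq ?_)
  rw [ENNReal.mul_rpow_of_nonneg _ _ (by positivity),
    ENNReal.coe_rpow_of_nonneg _ (by positivity), nonlocalSeminorm]

end SobolevInequality
theorem mainTheorem7 (d : ℕ) (hd : 1 ≤ d) (p : ℝ) (hp : 1 ≤ p)
    (ν ν₁ ν₂ : RSpace d → ℝ≥0∞)
    (hν : AEMeasurable ν volume) (hν₁ : AEMeasurable ν₁ volume) (hν₂ : AEMeasurable ν₂ volume)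
    (φ φ₁ φ₂ : ℝ≥0∞ → ℝ≥0∞)
    (hφ : IsCriticalFunction p ν φ)
    (hφ₁ : IsCriticalFunction p ν₁ φ₁) (hφ₂ : IsCriticalFunction p ν₂ φ₂)
    (hconv₁ : ConvexOn ℝ≥0 Set.univ (fun t : ℝ≥0∞ => φ₁ (t ^ (1 / p))))
    (hconv₂ : ConvexOn ℝ≥0 Set.univ (fun t : ℝ≥0∞ => φ₂ (t ^ (1 / p))))
    (hgrowth₁ : ∃ θ₁ : ℝ≥0, 0 < θ₁ ∧ GrowthCondition φ₁ θ₁)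
    (hgrowth₂ : ∃ θ₂ : ℝ≥0, 0 < θ₂ ∧ GrowthCondition φ₂ θ₂) :
    ((∀ t, φ t = max (φ₁ t) (φ₂ t)) →
      (∃ c₁ c₂ : ℝ≥0, 0 < c₁ ∧ c₁ ≤ c₂ ∧
        ∀ h : RSpace d, h ≠ 0 → c₁ * ν h ≤ max (ν₁ h) (ν₂ h) ∧ max (ν₁ h) (ν₂ h) ≤ c₂ * ν h) →
      ∃ C : ℝ≥0, 0 < C ∧ ∀ u : RSpace d → ℝ, MemOrlicz φ u →
        luxemburgNorm φ u ≤ C * nonlocalSeminorm p ν u) ∧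
    ((∀ t, φ t = min (φ₁ t) (φ₂ t)) →
      ∃ C : ℝ≥0, 0 < C ∧
        (∀ u : RSpace d → ℝ, MemOrlicz (phiMin φ₁ φ₂) u →
          luxemburgNorm (phiMin φ₁ φ₂) u ≤ C * nonlocalSeminorm p ν u) ∧
        (∀ u : RSpace d → ℝ, MemOrlicz φ u →
          luxemburgNorm φ u ≤ C * nonlocalSeminorm p ν u)) := by
  have hp0 : 0 < p := by linarith
  obtain ⟨θ₁, hθ₁, hg₁⟩ := hgrowth₁
  obtain ⟨θ₂, hθ₂, hg₂⟩ := hgrowth₂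
  obtain ⟨K₁, hK₁⟩ := hg₁.exists_isDoubling hθ₁ hφ₁.eq_zero_iff (hφ₁.eq_top_iff hp0)
  obtain ⟨K₂, hK₂⟩ := hg₂.exists_isDoubling hθ₂ hφ₂.eq_zero_iff (hφ₂.eq_top_iff hp0)
  replace hK₁ := hK₁.mono (le_max_left K₁ K₂)
  replace hK₂ := hK₂.mono (le_max_right K₁ K₂)
  have hs₁ := IsSubhomogeneous.of_convexOn hp (hφ₁.eq_zero_iff.2 rfl) hconv₁
  have hs₂ := IsSubhomogeneous.of_convexOn hp (hφ₂.eq_zero_iff.2 rfl) hconv₂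
  refine ⟨fun hmax _ => ?_, fun hmin => ?_⟩
  · obtain rfl : φ = fun t => max (φ₁ t) (φ₂ t) := funext hmax
    exact exists_luxemburgNorm_le hd hp0 hν hφ (hs₁.max hs₂) (hK₁.max hK₂)
  · obtain rfl : φ = fun t => min (φ₁ t) (φ₂ t) := funext hmin
    have htop : min (φ₁ ∞) (φ₂ ∞) = ∞ := (hφ.eq_top_iff hp0).2 rfl
    have h0 : min (φ₁ 0) (φ₂ 0) = 0 := hφ.eq_zero_iff.2 rfl
    have hsub := hs₁.min hs₂
    obtain ⟨C, hC0, hC⟩ := exists_luxemburgNorm_le hd hp0 hν hφ hsub (hK₁.min hK₂)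
    refine ⟨C, hC0, fun u hu => ?_, hC⟩
    obtain ⟨hmeas, c, hc, hfin⟩ := hu
    have hmem : MemOrlicz (fun t => min (φ₁ t) (φ₂ t)) u := by
      refine ⟨hmeas, c * 2, by positivity, ?_⟩
      calc ∫⁻ x, min (φ₁ (‖u x‖ₑ / (c * 2 : ℝ≥0))) (φ₂ (‖u x‖ₑ / (c * 2 : ℝ≥0)))
          ≤ ∫⁻ x, 2 * phiMin φ₁ φ₂ (‖u x‖ₑ / c) := by
            refine lintegral_mono fun x => ?_
            have hdiv : ‖u x‖ₑ / (c * 2 : ℝ≥0) = ‖u x‖ₑ / c / 2 := by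
              rw [div_eq_mul_inv, div_eq_mul_inv, div_eq_mul_inv, mul_assoc,
                ← ENNReal.mul_inv (by simp) (by simp)]
              push_cast
              rfl
            simp only [hdiv]
            exact le_two_mul_phiMin (hsub.monotone htop) h0
              (ENNReal.div_ne_top enorm_ne_top (by exact_mod_cast hc.ne'))
        _ = 2 * ∫⁻ x, phiMin φ₁ φ₂ (‖u x‖ₑ / c) :=
            lintegral_const_mul' _ _ ENNReal.ofNat_ne_top
        _ < ∞ := ENNReal.mul_lt_top (by simp) hfin
    -- Since `φ_min ≤ φ`, each scale admissible for `φ` is admissible for `φ_min`, so the same `C`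
    -- serves.
    refine le_trans (sInf_le_sInf ?_) (hC u hmem)
    rintro a ⟨b, hb, rfl, hle⟩
    exact ⟨b, hb, rfl, (lintegral_mono fun x => phiMin_le hsub htop _).trans hle⟩
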